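/- Let $\varphi$ be a norm on $\mathbb{R}^2$ whose unit ball $\{\varphi\le 1\}$ is strictly convex. For $A\subseteq\mathbb{R}^2$ let the Pareto hull of $A$ be $$\mathcal{P}(A)=\{x\in\mathbb{R}^2 : \text{for every } y\neq x \text{ there is } a\in A \text{ with } \varphi(a-x)<\varphi(a-y)\},$$ let the Pareto hull peeling of a finite set $A$ be $E_1(A)=\mathcal{P}(A)$, $E_{k+1}(A)=\mathcal{P}(A\cap \operatorname{int}E_k(A))$ for $k\geq 1$, and let $u_A=\sum_{k\ge1}1_{\operatorname{int}E_k(A)}$ be its height function. Then Pareto hull peeling is convex hull peeling: for every finite $A\subseteq\mathbb{R}^2$, the sets $E_k(A)$, $k\ge1$, are the same if $\mathcal{P}$ is replaced by the convex hull in the recursion. Moreover, let $U\subseteq\mathbb{R}^2$ be a bounded open set that is Pareto efficient, i.e. $\operatorname{int}\mathcal{P}(\overline U)=U$, and let $f:U\to(0,\infty)$ be bounded and continuous. For each $n\in\mathbb{N}$, $n\ge1$, let $X_{nf}$ be a Poisson point process in $U$ with intensity $nf$, all of them defined on one probability space (with arbitrary joint distribution), and let $u_n=u_{X_{nf}}$.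 Then, almost surely, $n^{-1/2}u_n\to\infty$ locally uniformly in $U$; that is, almost surely, for every compact $K\subseteq U$ and every $M\in\mathbb{R}$, one has $n^{-1/2}u_n(x)\ge M$ for all $x\in K$ and all sufficiently large $n$. -/

import Mathlib

open MeasureTheory ProbabilityTheory Filter Set
open scoped ENNReal NNReal

noncomputable section

/-- The Euclidean plane, carrying Lebesgue measure as `volume`. -/
abbrev Plane : Type := EuclideanSpace ℝ (Fin 2)

/-- The Pareto hull of `A` with respect to `φ`. For `A = ∅` the formula gives `∅`. -/
def paretoHull (φ : Plane → ℝ) (A : Set Plane) : Set Plane :=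
  {x | ∀ y, y ≠ x → ∃ a ∈ A, φ (a - x) < φ (a - y)}

/-- `U` is Pareto efficient: the interior of the Pareto hull of its closure is `U` itself. -/
def IsParetoEfficient (φ : Plane → ℝ) (U : Set Plane) : Prop :=
  interior (paretoHull φ (closure U)) = U

/-- Peeling of `A` by a hull operation: with `E₁ = hull A` and
`E_{k+1} = hull (A ∩ interior E_k)`, the set `peel hull A k` is `E_{k+1}` (indices start at `0`). -/
def peel (hull : Set Plane → Set Plane) (A : Set Plane) : ℕ → Set Plane
  | 0 => hull A
  | k + 1 => hull (A ∩ interior (peel hull A k))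

/-- The height function of Pareto hull peeling,
`u_A = ∑_{k ≥ 1} 1_{interior (E_k)}`, with values in `[0, ∞]`. -/
def paretoHeight (φ : Plane → ℝ) (A : Set Plane) (x : Plane) : ℝ≥0∞ :=
  ∑' k : ℕ, (interior (peel (paretoHull φ) A k)).indicator 1 x

/-- `X` is a Poisson point process with mean measure `μ`: a random countable set whose
number of points in a measurable set `B` is a random variable, Poisson distributed with
parameter `μ B` (almost surely infinite if `μ B = ∞`), the numbers of points in finitely many
pairwise disjoint measurable sets being independent. -/
structure IsPoissonProcess {Ω : Type*} [MeasurableSpace Ω] (P : Measure Ω)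
    (μ : Measure Plane) (X : Ω → Set Plane) : Prop where
  countable : ∀ ω, (X ω).Countable
  measurable_count : ∀ B, MeasurableSet B → Measurable fun ω => (X ω ∩ B).encard
  law_count : ∀ B, MeasurableSet B → μ B ≠ ∞ →
    P.map (fun ω => (X ω ∩ B).encard)
      = (poissonMeasure (μ B).toNNReal).map (fun k : ℕ => (k : ℕ∞))
  count_eq_top : ∀ B, MeasurableSet B → μ B = ∞ → ∀ᵐ ω ∂P, (X ω ∩ B).encard = ⊤
  indep_count : ∀ (m : ℕ) (B : Fin m → Set Plane), (∀ i, MeasurableSet (B i)) →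
    Pairwise (fun i j => Disjoint (B i) (B j)) →
    iIndepFun (fun i ω => (X ω ∩ B i).encard) P

/-- The measure on the plane that is carried by `U` and has density `g` there. -/
def intensityMeasure (U : Set Plane) (g : Plane → ℝ) : Measure Plane :=
  (volume.restrict U).withDensity fun x => ENNReal.ofReal (g x)

/-- `v n → ∞` locally uniformly in `U`, that is, uniformly on each compact subset of `U`. -/
def TendstoInftyLocallyUniformlyOn (v : ℕ → Plane → ℝ) (U : Set Plane) : Prop :=
  ∀ K, K ⊆ U → IsCompact K → ∀ M : ℝ, ∀ᶠ n in atTop, ∀ x ∈ K, M ≤ v n x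

end

/-!
The Pareto hull of a finite set is its convex hull, in both directions because of Birkhoff
orthogonality: if `b` is the shortest vector on the line `b + ℝ v`, then `t ↦ φ (α b + t v)` is
smallest at `t = 0`, and strictly so by strict convexity. For a given `v` this confines all points
at least as close to `x + v` as to `x` to an open half-plane bounded by `x + ℝ b`, so that none of
the `x` in the convex hull can be improved (`convexHull_subset_paretoHull`). Conversely, if a
line separates `x` from `A`, then moving from `x` in the direction that is Birkhoff orthogonal to
the line improves the distance to all points of `A` (`paretoHull_subset_convexHull`). This uses
that the plane is two-dimensional.

The growth of the height is therefore a statement on convex layers. Suppose that a disc of radius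
`r` lies in the interior of a layer. If each of its caps of depth `δ` contains a point, then the
next layer contains the concentric disc of radius `r - δ` (`ball_subset_convexHull_of_caps`).
Starting from a disc of radius `2 r₀` in `U`, one finds `m` layers around the disc of radius `r₀`
if this works with `δ = r₀ / m`. Caps of depth `δ` have area of order `δ ^ (3 / 2)`. With
`m ∼ M √n` the expected number of points in a cap is thus at least a multiple of `n ^ (1 / 4)`, and
it is enough to look at a family of `O (m ^ 2)` caps (`le_toReal_paretoHeight_of_testCap`). The
probability that one of them is empty is `O (n exp (-L n ^ (1 / 4)))`, which is summable in `n`, so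
the Borel-Cantelli lemma applies whatever the joint distribution of the processes is
(`ae_eventually_testCap_nonempty`). Countably many discs cover `U`, and finitely many of them
cover a given compact set.
-/

/-! ### Pareto hulls of finite sets are convex hulls -/

theorem continuous_seminorm_plane (φ : Seminorm ℝ Plane) : Continuous φ :=
  φ.convexOn.locallyLipschitz.continuous

theorem seminorm_combo_le (φ : Seminorm ℝ Plane) {r s : ℝ} (hr : 0 ≤ r) (hs : 0 ≤ s)
    (x y : Plane) : φ (r • x + s • y) ≤ r * φ x + s * φ y := by
  refine (map_add_le_add φ _ _).trans (le_of_eq ?_)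
  rw [map_smul_eq_mul φ r, map_smul_eq_mul φ s, Real.norm_of_nonneg hr, Real.norm_of_nonneg hs]

theorem linear_apply_eq_coords (p : Plane →ₗ[ℝ] ℝ) (x : Plane) :
    p x = x 0 * p (EuclideanSpace.single 0 1) + x 1 * p (EuclideanSpace.single 1 1) := by
  have : x = x 0 • EuclideanSpace.single 0 (1 : ℝ) + x 1 • EuclideanSpace.single 1 (1 : ℝ) := by
    ext i
    fin_cases i <;> simp
  conv_lhs => rw [this]
  simp

theorem interior_seminorm_le_one_subset (φ : Seminorm ℝ Plane) :
    interior {x : Plane | φ x ≤ 1} ⊆ {x | φ x < 1} := by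
  intro z hz
  have hz1 : z ∈ {x : Plane | φ x ≤ 1} := interior_subset hz
  refine lt_of_le_of_ne (show φ z ≤ 1 from hz1) fun h1 => ?_
  have hc : ContinuousAt (fun t : ℝ => (1 + t) • z) 0 := by fun_prop
  have hn : {x : Plane | φ x ≤ 1} ∈ nhds ((1 + (0 : ℝ)) • z) := by
    simpa using mem_interior_iff_mem_nhds.1 hz
  obtain ⟨ε, hε, hball⟩ := Metric.mem_nhds_iff.1 (hc hn)
  have : φ ((1 + ε / 2) • z) ≤ 1 := by
    apply hball
    rw [Metric.mem_ball, Real.dist_eq, sub_zero, abs_of_pos (by linarith)]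
    linarith
  rw [map_smul_eq_mul, h1, Real.norm_of_nonneg (by linarith)] at this
  linarith

/-- Strict convexity of the unit ball, in the form of a strict midpoint inequality. -/
theorem seminorm_midpoint_lt {φ : Seminorm ℝ Plane} (hφ : ∀ x, φ x = 0 → x = 0)
    (hstrict : StrictConvex ℝ {x : Plane | φ x ≤ 1}) {u w : Plane} (huw : u ≠ w)
    (h : φ u = φ w) : φ ((1 / 2 : ℝ) • u + (1 / 2 : ℝ) • w) < φ u := by
  have hu : 0 < φ u := by
    refine lt_of_le_of_ne (apply_nonneg φ u) fun h0 => huw ?_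
    rw [hφ u h0.symm, hφ w (h ▸ h0.symm)]
  have hu' : φ u ≠ 0 := hu.ne'
  have key := interior_seminorm_le_one_subset φ <| hstrict
    (x := (φ u)⁻¹ • u) (y := (φ u)⁻¹ • w)
    (by simp [map_smul_eq_mul, abs_of_pos hu, hu'])
    (by simp [map_smul_eq_mul, ← h, abs_of_pos hu, hu'])
    (fun e => huw (smul_right_injective _ (inv_ne_zero hu') e))
    (a := 1 / 2) (b := 1 / 2) (by norm_num) (by norm_num) (by norm_num)
  have e : (1 / 2 : ℝ) • (φ u)⁻¹ • u + (1 / 2 : ℝ) • (φ u)⁻¹ • w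
      = (φ u)⁻¹ • ((1 / 2 : ℝ) • u + (1 / 2 : ℝ) • w) := by module
  rw [mem_ofPred_eq, e, map_smul_eq_mul, Real.norm_of_nonneg (by positivity),
    inv_mul_lt_iff₀ hu, mul_one] at key
  exact key

/-- If `b` is the shortest point of the line `b + ℝ v`, then `α b` is the shortest point of
`α b + ℝ v`. -/
theorem seminorm_smul_le_of_minimal {φ : Seminorm ℝ Plane} {b v : Plane}
    (hb : ∀ t : ℝ, φ b ≤ φ (b + t • v)) (α t : ℝ) : φ (α • b) ≤ φ (α • b + t • v) := by
  rcases eq_or_ne α 0 with rfl | hα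
  · simp
  · have e : α • b + t • v = α • (b + (t / α) • v) := by
      rw [smul_add, smul_smul, mul_div_cancel₀ _ hα]
    rw [e, map_smul_eq_mul, map_smul_eq_mul]
    exact mul_le_mul_of_nonneg_left (hb _) (norm_nonneg _)

theorem seminorm_smul_lt_of_minimal {φ : Seminorm ℝ Plane} (hφ : ∀ x, φ x = 0 → x = 0)
    (hstrict : StrictConvex ℝ {x : Plane | φ x ≤ 1}) {b v : Plane} (hv : v ≠ 0)
    (hb : ∀ t : ℝ, φ b ≤ φ (b + t • v)) (α : ℝ) {t : ℝ} (ht : t ≠ 0) :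
    φ (α • b) < φ (α • b + t • v) := by
  refine lt_of_le_of_ne (seminorm_smul_le_of_minimal hb α t) fun h => ?_
  have hne : α • b ≠ α • b + t • v := by simp [ht, hv]
  have h1 := seminorm_midpoint_lt hφ hstrict hne h
  have e : (1 / 2 : ℝ) • (α • b) + (1 / 2 : ℝ) • (α • b + t • v)
      = α • b + (t / 2) • v := by module
  rw [e] at h1
  exact absurd (seminorm_smul_le_of_minimal hb α (t / 2)) (not_le.2 h1)

/-- Every line `c + ℝ v` has a point of smallest norm, because `φ (c + t v)` grows with `|t|`. -/
theorem exists_minimal_on_line {φ : Seminorm ℝ Plane} (hφ : ∀ x, φ x = 0 → x = 0)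
    (c : Plane) {v : Plane} (hv : v ≠ 0) :
    ∃ t₀ : ℝ, ∀ t : ℝ, φ (c + t₀ • v) ≤ φ ((c + t₀ • v) + t • v) := by
  have hpos : 0 < φ v := lt_of_le_of_ne (apply_nonneg φ v) fun h => hv (hφ v h.symm)
  have hcont : Continuous fun t : ℝ => φ (c + t • v) :=
    (continuous_seminorm_plane φ).comp (by fun_prop)
  obtain ⟨t₀, ht₀⟩ := hcont.exists_forall_le' (x₀ := 0) (by
    have h1 : ∀ᶠ t : ℝ in cocompact ℝ, 2 * φ c / φ v ≤ ‖t‖ :=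
      (tendsto_norm_cocompact_atTop (E := ℝ)).eventually_ge_atTop _
    filter_upwards [h1] with t ht
    rw [div_le_iff₀ hpos] at ht
    have h2 : φ (t • v) ≤ φ (c + t • v) + φ c := by
      have := map_sub_le_add φ (c + t • v) c
      rwa [add_sub_cancel_left] at this
    rw [map_smul_eq_mul] at h2
    simp only [zero_smul, add_zero]
    linarith)
  refine ⟨t₀, fun t => ?_⟩
  have := ht₀ (t₀ + t)
  rwa [add_smul, ← add_assoc] at this

/-- The direction `v` cuts out a half-plane: moving the reference point from `0` to `v` can only
bring it closer to points strictly on the `v`-side of the line through `0` and the shortest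
vector `b` among those of the form `c + t v`. -/
theorem exists_linear_pos_of_seminorm_sub_le {φ : Seminorm ℝ Plane} (hφ : ∀ x, φ x = 0 → x = 0)
    (hstrict : StrictConvex ℝ {x : Plane | φ x ≤ 1}) {v : Plane} (hv : v ≠ 0) :
    ∃ l : Plane →ₗ[ℝ] ℝ, ∀ a, φ (a - v) ≤ φ a → 0 < l a := by
  have hN : 0 < v 0 ^ 2 + v 1 ^ 2 := by
    by_contra! hle
    apply hv
    ext i
    fin_cases i
    · change v 0 = 0
      nlinarith [sq_nonneg (v 0), sq_nonneg (v 1)]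
    · change v 1 = 0
      nlinarith [sq_nonneg (v 0), sq_nonneg (v 1)]
  set N := v 0 ^ 2 + v 1 ^ 2 with hNdef
  obtain ⟨t₀, ht₀⟩ := exists_minimal_on_line hφ (!₂[-v 1, v 0] : Plane) hv
  set b : Plane := !₂[-v 1, v 0] + t₀ • v with hbdef
  have hb0 : b 0 = -v 1 + t₀ * v 0 := by simp [hbdef]
  have hb1 : b 1 = v 0 + t₀ * v 1 := by simp [hbdef]
  let p₀ : Plane →ₗ[ℝ] ℝ := (EuclideanSpace.proj (𝕜 := ℝ) (0 : Fin 2)).toLinearMap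
  let p₁ : Plane →ₗ[ℝ] ℝ := (EuclideanSpace.proj (𝕜 := ℝ) (1 : Fin 2)).toLinearMap
  -- `α` and `l` are the coordinates with respect to the basis `b`, `v`.
  let α : Plane →ₗ[ℝ] ℝ := (-v 1 / N) • p₀ + (v 0 / N) • p₁
  let l : Plane →ₗ[ℝ] ℝ := (v 0 / N) • p₀ + (v 1 / N) • p₁ - t₀ • α
  have hα : ∀ a, α a = -v 1 / N * a 0 + v 0 / N * a 1 := fun a => rfl
  have hl : ∀ a, l a = v 0 / N * a 0 + v 1 / N * a 1 - t₀ * α a := fun a => rfl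
  have hdec : ∀ a : Plane, a = α a • b + l a • v := by
    intro a
    ext i
    fin_cases i
    · simp only [Fin.zero_eta, PiLp.add_apply, PiLp.smul_apply, smul_eq_mul, hb0, hl, hα]
      field_simp
      rw [hNdef]
      ring
    · simp only [Fin.mk_one, PiLp.add_apply, PiLp.smul_apply, smul_eq_mul, hb1, hl, hα]
      field_simp
      rw [hNdef]
      ring
  refine ⟨l, fun a ha => ?_⟩
  by_contra! hle
  set β := l a
  have hs : 0 < 1 - β := by linarith
  have hlt := seminorm_smul_lt_of_minimal hφ hstrict hv ht₀ (α a) (t := β - 1) (by linarith)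
  have ea : a - v = α a • b + (β - 1) • v := by
    conv_lhs => rw [hdec a]
    module
  rw [← ea] at hlt
  -- `a` lies between `α a • b` and `a - v`, strictly before `a - v`.
  have ec : a = (1 / (1 - β)) • (α a • b) + (-β / (1 - β)) • (a - v) := by
    rw [ea]
    have h1 : (1 / (1 - β)) + (-β / (1 - β)) = 1 := by field_simp; ring
    have h2 : (-β / (1 - β)) * (β - 1) = β := by field_simp; ring
    have h3 : ∀ B : Plane, B + β • v
        = (1 / (1 - β)) • B + (-β / (1 - β)) • (B + (β - 1) • v) := fun B => by
      rw [smul_add, ← add_assoc, ← add_smul, h1, one_smul, smul_smul, h2]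
    exact (hdec a).trans (h3 _)
  have h3 : φ a ≤ (1 / (1 - β)) * φ (α a • b) + (-β / (1 - β)) * φ (a - v) := by
    conv_lhs => rw [ec]
    exact seminorm_combo_le φ (by positivity) (div_nonneg (by linarith) hs.le) _ _
  have h4 : (1 / (1 - β)) * φ (α a • b) < (1 / (1 - β)) * φ (a - v) :=
    mul_lt_mul_of_pos_left hlt (by positivity)
  have h5 : (1 / (1 - β)) * φ (a - v) + (-β / (1 - β)) * φ (a - v) = φ (a - v) := by
    field_simp
    ring
  linarith

/-- A convex combination `x` of points of `A` is in the Pareto hull: if some `y` were at least as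
close to all of `A`, then `A` would lie in an open half-plane with `x` on its boundary. -/
theorem convexHull_subset_paretoHull {φ : Seminorm ℝ Plane} (hφ : ∀ x, φ x = 0 → x = 0)
    (hstrict : StrictConvex ℝ {x : Plane | φ x ≤ 1}) (A : Set Plane) :
    convexHull ℝ A ⊆ paretoHull φ A := by
  intro x hx y hyx
  by_contra! hcon
  obtain ⟨l, hl⟩ := exists_linear_pos_of_seminorm_sub_le hφ hstrict (sub_ne_zero.2 hyx)
  have hsub : convexHull ℝ A ⊆ {z | l x < l z} := by
    refine convexHull_min (fun a ha => ?_) (convex_halfSpace_gt l.isLinear _)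
    have h1 := hl (a - x) (by simpa using hcon a ha)
    rw [map_sub] at h1
    exact sub_pos.1 h1
  exact lt_irrefl (l x) (hsub hx)

/-- Birkhoff orthogonality: some nonzero `v` has `w` as the shortest point of `w + ℝ v`. The
direction `v` spans the kernel of a functional supporting the ball `{φ < φ w}` at `w`. -/
theorem exists_direction_minimal (φ : Seminorm ℝ Plane) {w : Plane} (hw : 0 < φ w) :
    ∃ (p : Plane →ₗ[ℝ] ℝ) (v : Plane), 0 < p w ∧ v ≠ 0 ∧ p v = 0 ∧
      ∀ t : ℝ, φ w ≤ φ (w + t • v) := by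
  have hconv : Convex ℝ {a : Plane | φ a < φ w} := by
    simpa [Seminorm.ball_zero_eq] using φ.convex_ball 0 (φ w)
  have hopen : IsOpen {a : Plane | φ a < φ w} :=
    isOpen_lt (continuous_seminorm_plane φ) continuous_const
  obtain ⟨p, hp⟩ := geometric_hahn_banach_open_point hconv hopen (x := w)
    (fun h : φ w < φ w => lt_irrefl _ h)
  have hpw : 0 < p w := by simpa using hp 0 (by simpa using hw)
  set e₀ : Plane := EuclideanSpace.single 0 1
  set e₁ : Plane := EuclideanSpace.single 1 1
  have hpx : ∀ x : Plane, p x = x 0 * p e₀ + x 1 * p e₁ :=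
    linear_apply_eq_coords p.toLinearMap
  have hv : (!₂[-p e₁, p e₀] : Plane) ≠ 0 := by
    intro h
    have h0 : -p e₁ = 0 := by simpa using congrArg (fun z : Plane => z 0) h
    have h1 : p e₀ = 0 := by simpa using congrArg (fun z : Plane => z 1) h
    rw [hpx, h1, neg_eq_zero.1 h0] at hpw
    simp at hpw
  have hpv : p (!₂[-p e₁, p e₀] : Plane) = 0 := by
    rw [hpx]
    simp
    ring
  refine ⟨p.toLinearMap, !₂[-p e₁, p e₀], hpw, hv, hpv, fun t => ?_⟩
  by_contra! hlt
  have := hp _ hlt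
  rw [map_add, map_smul, hpv] at this
  simp at this

/-- A point outside the convex hull of a finite set can be moved closer to all points of the
set at once: the direction of motion is Birkhoff orthogonal to the separating line. -/
theorem paretoHull_subset_convexHull {φ : Seminorm ℝ Plane} (hφ : ∀ x, φ x = 0 → x = 0)
    {A : Set Plane} (hA : A.Finite) : paretoHull φ A ⊆ convexHull ℝ A := by
  intro x hx
  by_contra hxA
  obtain ⟨l, u, hlx, hlu⟩ := geometric_hahn_banach_point_closed (convex_convexHull ℝ A)
    (hA.isClosed_convexHull ℝ) hxA
  have hlA : ∀ a ∈ A, 0 < l (a - x) := fun a ha => by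
    rw [map_sub]
    linarith [hlu a (subset_convexHull ℝ A ha)]
  obtain ⟨y₀, hy₀⟩ : ∃ y : Plane, y ≠ x := exists_ne x
  obtain ⟨a₀, ha₀, -⟩ := hx y₀ hy₀
  set e₀ : Plane := EuclideanSpace.single 0 1
  set e₁ : Plane := EuclideanSpace.single 1 1
  have hlz : ∀ x : Plane, l x = x 0 * l e₀ + x 1 * l e₁ :=
    linear_apply_eq_coords l.toLinearMap
  set w : Plane := !₂[-l e₁, l e₀] with hw
  have hN : 0 < l e₀ ^ 2 + l e₁ ^ 2 := by
    by_contra! hle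
    have h0 : l e₀ = 0 := by nlinarith [sq_nonneg (l e₀), sq_nonneg (l e₁)]
    have h1 : l e₁ = 0 := by nlinarith [sq_nonneg (l e₀), sq_nonneg (l e₁)]
    have := hlA a₀ ha₀
    rw [hlz, h0, h1] at this
    simp at this
  -- the kernel of `l` is spanned by `w`
  have hker : ∀ z : Plane, l z = 0 → ∃ α : ℝ, z = α • w := by
    intro z hz
    rw [hlz] at hz
    refine ⟨(-l e₁ * z 0 + l e₀ * z 1) / (l e₀ ^ 2 + l e₁ ^ 2), ?_⟩
    ext i
    fin_cases i
    · simp [hw]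
      field_simp
      linear_combination l e₀ * hz
    · simp [hw]
      field_simp
      linear_combination l e₁ * hz
  have hwpos : 0 < φ w := by
    refine lt_of_le_of_ne (apply_nonneg φ w) fun h => ?_
    have hw0 := hφ w h.symm
    have h0 : -l e₁ = 0 := by simpa [hw] using congrArg (fun z : Plane => z 0) hw0
    have h1 : l e₀ = 0 := by simpa [hw] using congrArg (fun z : Plane => z 1) hw0
    rw [h1, neg_eq_zero.1 h0] at hN
    simp at hN
  obtain ⟨p, v, hpw, hv, hpv, hmin⟩ := exists_direction_minimal φ hwpos
  have hlv : l v ≠ 0 := by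
    intro h
    obtain ⟨α, rfl⟩ := hker v h
    rw [map_smul, smul_eq_mul] at hpv
    rcases mul_eq_zero.1 hpv with h | h
    · exact hv (by simp [h])
    · exact hpw.ne' h
  -- the common step length: all `a ∈ A` have `l`-height at least `m`
  obtain ⟨a₁, ha₁, hmin₁⟩ := hA.exists_minimalFor (fun a => l (a - x)) A ⟨a₀, ha₀⟩
  have hm : ∀ a ∈ A, l (a₁ - x) ≤ l (a - x) := fun a ha => by
    rcases le_total (l (a₁ - x)) (l (a - x)) with h | h
    · exact h
    · exact hmin₁ ha h
  set m := l (a₁ - x)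
  have hmpos : 0 < m := hlA a₁ ha₁
  set s := m / l v with hs
  have hs0 : s ≠ 0 := div_ne_zero hmpos.ne' hlv
  obtain ⟨a, ha, hlt⟩ := hx (x + s • v) (by simp [hs0, hv])
  refine absurd hlt (not_lt.2 ?_)
  set β := l (a - x) / l v with hβ
  obtain ⟨α, hα⟩ := hker ((a - x) - β • v) (by
    rw [map_sub, map_smul, smul_eq_mul, hβ, div_mul_cancel₀ _ hlv, sub_self])
  have hminα := seminorm_smul_le_of_minimal hmin α β
  have ea : α • w + β • v = a - x := by rw [← hα]; abel
  rw [ea] at hminα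
  -- `a - x - s v` is a convex combination of `a - x` and the shortest point `α w`
  set r := m / l (a - x) with hr
  have hlpos := hlA a ha
  have hr0 : 0 ≤ r := by positivity
  have hr1 : r ≤ 1 := (div_le_one hlpos).2 (hm a ha)
  have hrβ : r * β = s := by
    rw [hr, hβ, hs]
    field_simp
  have ec : a - (x + s • v) = r • (α • w) + (1 - r) • (a - x) := by
    rw [← hα, ← hrβ]
    module
  rw [ec]
  refine (seminorm_combo_le φ hr0 (sub_nonneg.2 hr1) _ _).trans ?_
  nlinarith

theorem peel_paretoHull_eq {φ : Seminorm ℝ Plane} (hφ : ∀ x, φ x = 0 → x = 0)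
    (hstrict : StrictConvex ℝ {x : Plane | φ x ≤ 1}) {A : Set Plane} (hA : A.Finite) (k : ℕ) :
    peel (paretoHull φ) A k = peel (fun S => convexHull ℝ S) A k := by
  have h : ∀ S : Set Plane, S.Finite → paretoHull φ S = convexHull ℝ S := fun S hS =>
    (paretoHull_subset_convexHull hφ hS).antisymm (convexHull_subset_paretoHull hφ hstrict S)
  induction k with
  | zero => exact h A hA
  | succ k ih => rw [peel, peel, ih, h _ (hA.inter_of_left _)]

/-! ### Convex layers and inscribed discs -/

theorem convex_peel_convexHull (A : Set Plane) (k : ℕ) :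
    Convex ℝ (peel (fun S => convexHull ℝ S) A k) := by
  cases k <;> exact convex_convexHull ℝ _

theorem norm_lt_of_mem_interior_convexHull {S : Set Plane} {a x : Plane}
    (hS : ∀ b ∈ S, ‖b‖ ≤ ‖a‖) (hx : x ∈ interior (convexHull ℝ S)) : ‖x‖ < ‖a‖ := by
  have h : convexHull ℝ S ⊆ Metric.closedBall 0 ‖a‖ :=
    convexHull_min (fun b hb => by simpa using hS b hb) (convex_closedBall _ _)
  have := interior_mono h hx
  rw [interior_closedBall'] at this
  simpa using this

/-- Each round of peeling removes at least one point, namely a point of largest norm among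
those that are left. -/
theorem ncard_inter_interior_peel_lt {A : Set Plane} (hA : A.Finite) (k : ℕ)
    (hne : (A ∩ interior (peel (fun S => convexHull ℝ S) A k)).Nonempty) :
    (A ∩ interior (peel (fun S => convexHull ℝ S) A (k + 1))).ncard
      < (A ∩ interior (peel (fun S => convexHull ℝ S) A k)).ncard := by
  set B := A ∩ interior (peel (fun S => convexHull ℝ S) A k) with hB
  have hBfin : B.Finite := hA.inter_of_left _
  refine ncard_lt_ncard ?_ hBfin
  have hsub : convexHull ℝ B ⊆ interior (peel (fun S => convexHull ℝ S) A k) :=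
    convexHull_min inter_subset_right (convex_peel_convexHull A k).interior
  obtain ⟨a, haB, hmax⟩ := hBfin.exists_maximalFor (fun b => ‖b‖) B hne
  have hle : ∀ b ∈ B, ‖b‖ ≤ ‖a‖ := fun b hb => by
    rcases le_total ‖b‖ ‖a‖ with h | h
    · exact h
    · exact hmax hb h
  refine ⟨fun x hx => ⟨hx.1, hsub (interior_subset hx.2)⟩, fun hsup => ?_⟩
  exact lt_irrefl ‖a‖ (norm_lt_of_mem_interior_convexHull hle (hsup haB).2)

theorem exists_inter_interior_peel_eq_empty {A : Set Plane} (hA : A.Finite) :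
    ∃ k₀, ∀ k, k₀ ≤ k → A ∩ interior (peel (fun S => convexHull ℝ S) A k) = ∅ := by
  have hcard : ∀ k, A ∩ interior (peel (fun S => convexHull ℝ S) A k) = ∅ ∨
      (A ∩ interior (peel (fun S => convexHull ℝ S) A k)).ncard + k ≤ A.ncard := by
    intro k
    induction k with
    | zero => exact Or.inr (ncard_le_ncard inter_subset_left hA)
    | succ k ih =>
      rcases ih with h | h
      · left
        rw [peel, h]
        simp
      · rcases eq_empty_or_nonempty
          (A ∩ interior (peel (fun S => convexHull ℝ S) A k)) with he | hne
        · left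
          rw [peel, he]
          simp
        · right
          have := ncard_inter_interior_peel_lt hA k hne
          omega
  refine ⟨A.ncard, fun k hk => ?_⟩
  rcases hcard k with h | h
  · exact h
  · rw [← ncard_eq_zero (hA.inter_of_left _)]
    omega

/-- Finiteness of the height, without which its `toReal` would be the junk value `0`. -/
theorem paretoHeight_ne_top {φ : Seminorm ℝ Plane} (hφ : ∀ x, φ x = 0 → x = 0)
    (hstrict : StrictConvex ℝ {x : Plane | φ x ≤ 1}) {A : Set Plane} (hA : A.Finite)
    (x : Plane) : paretoHeight φ A x ≠ ∞ := by
  obtain ⟨k₀, hk₀⟩ := exists_inter_interior_peel_eq_empty hA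
  rw [paretoHeight, tsum_eq_sum (s := Finset.range (k₀ + 1))]
  · refine ENNReal.sum_ne_top.2 fun k _ => ?_
    exact ((indicator_le_self _ _ x).trans_lt ENNReal.one_lt_top).ne
  · intro k hk
    obtain ⟨j, rfl⟩ : ∃ j, k = j + 1 :=
      ⟨k - 1, by simp only [Finset.mem_range] at hk; omega⟩
    rw [peel_paretoHull_eq hφ hstrict hA, peel, hk₀ j (by simp at hk; omega)]
    simp

theorem le_toReal_paretoHeight {φ : Seminorm ℝ Plane} (hφ : ∀ x, φ x = 0 → x = 0)
    (hstrict : StrictConvex ℝ {x : Plane | φ x ≤ 1}) {A : Set Plane} (hA : A.Finite)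
    {x : Plane} {m : ℕ}
    (hx : ∀ k < m, x ∈ interior (peel (fun S => convexHull ℝ S) A k)) :
    (m : ℝ) ≤ (paretoHeight φ A x).toReal := by
  have h : (m : ℝ≥0∞) ≤ paretoHeight φ A x := by
    refine le_trans (le_of_eq ?_) (ENNReal.sum_le_tsum (Finset.range m))
    rw [Finset.sum_congr rfl (g := fun _ => 1)]
    · simp
    · intro k hk
      rw [peel_paretoHull_eq hφ hstrict hA, indicator_of_mem (hx k (Finset.mem_range.1 hk))]
      rfl
  have := ENNReal.toReal_mono (paretoHeight_ne_top hφ hstrict hA x) h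
  simpa using this

/-- If every cap of depth `δ` of the disc of radius `r` about `c` contains a point of `A` inside
the disc, then the concentric disc of radius `r - δ` lies in the hull of these points. -/
theorem ball_subset_convexHull_of_caps {A : Set Plane} (hA : A.Finite) {c : Plane} {r δ : ℝ}
    (hcap : ∀ t : ℝ, |t| ≤ Real.pi → ∃ a ∈ A ∩ Metric.ball c r,
      r - δ ≤ (a 0 - c 0) * Real.cos t + (a 1 - c 1) * Real.sin t) :
    Metric.ball c (r - δ) ⊆ convexHull ℝ (A ∩ Metric.ball c r) := by
  intro z hz
  by_contra hzA
  obtain ⟨l, u, hlz, hlu⟩ := geometric_hahn_banach_point_closed (convex_convexHull ℝ _)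
    ((hA.inter_of_left _).isClosed_convexHull ℝ) hzA
  -- `l` is a negative multiple of the coordinate in the direction with angle `t`
  set ζ : ℂ := ⟨-l (EuclideanSpace.single 0 1), -l (EuclideanSpace.single 1 1)⟩ with hζ
  have hl : ∀ x : Plane,
      l x = -(‖ζ‖ * (x 0 * Real.cos ζ.arg + x 1 * Real.sin ζ.arg)) := by
    intro x
    have h0 := Complex.norm_mul_cos_arg ζ
    have h1 := Complex.norm_mul_sin_arg ζ
    have h2 := linear_apply_eq_coords l.toLinearMap x
    simp only [ContinuousLinearMap.coe_coe] at h2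
    rw [h2]
    simp only [hζ] at h0 h1 ⊢
    linear_combination x 0 * h0 + x 1 * h1
  obtain ⟨a, ha, hat⟩ := hcap ζ.arg (Complex.abs_arg_le_pi ζ)
  have h3 := hlz.trans (hlu a (subset_convexHull ℝ _ ha))
  rw [hl, hl, neg_lt_neg_iff] at h3
  have h4 := lt_of_mul_lt_mul_left h3 (norm_nonneg ζ)
  rw [Metric.mem_ball, EuclideanSpace.dist_eq, Fin.sum_univ_two, Real.dist_eq, Real.dist_eq,
    sq_abs, sq_abs] at hz
  have hr : 0 < r - δ := (Real.sqrt_nonneg _).trans_lt hz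
  rw [Real.sqrt_lt' hr] at hz
  have h5 : r - δ < (z 0 - c 0) * Real.cos ζ.arg + (z 1 - c 1) * Real.sin ζ.arg := by linarith
  nlinarith [Real.sin_sq_add_cos_sq ζ.arg,
    sq_nonneg ((z 0 - c 0) * Real.sin ζ.arg - (z 1 - c 1) * Real.cos ζ.arg)]

/-- One layer of peeling shrinks an inscribed disc by at most `δ`, as long as the caps of depth
`δ` are occupied. -/
theorem ball_subset_interior_peel {A : Set Plane} (hA : A.Finite) {c : Plane} {R δ : ℝ} {m : ℕ}
    (hcap : ∀ k < m, ∀ t : ℝ, |t| ≤ Real.pi → ∃ a ∈ A ∩ Metric.ball c (R - k * δ),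
      R - k * δ - δ ≤ (a 0 - c 0) * Real.cos t + (a 1 - c 1) * Real.sin t) :
    ∀ k < m, Metric.ball c (R - (k + 1) * δ)
      ⊆ interior (peel (fun S => convexHull ℝ S) A k) := by
  intro k hk
  have h := ball_subset_convexHull_of_caps hA (hcap k hk)
  rw [show R - k * δ - δ = R - (k + 1) * δ by ring] at h
  refine interior_maximal (h.trans ?_) Metric.isOpen_ball
  induction k with
  | zero => exact convexHull_mono inter_subset_left
  | succ k ih =>
    have hk' : k < m := by omega
    have h' := ball_subset_convexHull_of_caps hA (hcap k hk')
    rw [show R - k * δ - δ = R - (k + 1) * δ by ring] at h'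
    refine convexHull_mono (inter_subset_inter_right _ ?_)
    rw [Nat.cast_add_one]
    exact interior_maximal (h'.trans (ih hk' h')) Metric.isOpen_ball

/-! ### Test sets inside the caps of a disc -/

/-- The ellipse with half-axes `α` in the direction with angle `t` and `β` orthogonally to it,
centred at distance `s` from `c` in that direction. -/
def capEllipse (c : Plane) (t s α β : ℝ) : Set Plane :=
  {a | (((a 0 - c 0) * Real.cos t + (a 1 - c 1) * Real.sin t - s) / α) ^ 2
    + (((a 1 - c 1) * Real.cos t - (a 0 - c 0) * Real.sin t) / β) ^ 2 < 1}

theorem measurableSet_capEllipse (c : Plane) (t s α β : ℝ) :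
    MeasurableSet (capEllipse c t s α β) :=
  (isOpen_lt (by fun_prop) continuous_const).measurableSet

theorem volume_capEllipse (c : Plane) (t s : ℝ) {α β : ℝ} (hα : 0 < α) (hβ : 0 < β) :
    volume (capEllipse c t s α β) = ENNReal.ofReal (α * β * Real.pi) := by
  set M : Matrix (Fin 2) (Fin 2) ℝ :=
    !![Real.cos t / α, Real.sin t / α; -Real.sin t / β, Real.cos t / β] with hM
  set T : Plane →ₗ[ℝ] Plane := Matrix.toLpLin 2 2 M with hT
  have hT0 : ∀ a : Plane, T a 0 = Real.cos t / α * a 0 + Real.sin t / α * a 1 := by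
    intro a
    simp [hT, hM, Matrix.toLpLin_apply, dotProduct, Fin.sum_univ_two]
  have hT1 : ∀ a : Plane, T a 1 = -Real.sin t / β * a 0 + Real.cos t / β * a 1 := by
    intro a
    simp [hT, hM, Matrix.toLpLin_apply, dotProduct, Fin.sum_univ_two]
  have hdet : LinearMap.det T = (α * β)⁻¹ := by
    rw [hT, Matrix.toLpLin_eq_toLin, LinearMap.det_toLin, hM, Matrix.det_fin_two_of]
    field_simp
    linear_combination Real.cos_sq_add_sin_sq t
  have hpre : capEllipse c t s α β = T ⁻¹' Metric.ball (T c + !₂[s / α, 0]) 1 := by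
    ext a
    rw [mem_preimage, Metric.mem_ball, EuclideanSpace.dist_eq, Fin.sum_univ_two, Real.dist_eq,
      Real.dist_eq, sq_abs, sq_abs, Real.sqrt_lt' one_pos, one_pow]
    simp only [PiLp.add_apply, hT0, hT1, capEllipse, mem_ofPred_eq]
    refine iff_of_eq (congrArg₂ _ (congrArg₂ _ (congrArg (· ^ 2) ?_) (congrArg (· ^ 2) ?_)) rfl)
    · simp
      ring
    · simp
      ring
  rw [hpre, Measure.addHaar_preimage_linearMap volume (by rw [hdet]; positivity), hdet, inv_inv,
    abs_of_pos (by positivity), EuclideanSpace.volume_ball_fin_two,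
    ENNReal.ofReal_one, one_pow, one_mul, ENNReal.ofReal_mul (p := α * β) (by positivity),
    ← NNReal.coe_real_pi, ENNReal.ofReal_coe_nnreal]

/-- The test sets. With `δ = r₀ / m` and `r = 2 r₀ - k δ`, this is an ellipse of width `∼ δ` and
length `∼ √δ` contained in the cap of depth `δ / 2` of the disc of radius `r` about `c`, in the
direction with angle `j / (8 m)`. -/
def testCap (c : Plane) (r₀ : ℝ) (m k : ℕ) (j : ℤ) : Set Plane :=
  capEllipse c (j / (8 * m)) (2 * r₀ - k * (r₀ / m) - 3 * (r₀ / m) / 8) (r₀ / m / 8)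
    (√(r₀ * (r₀ / m)) / 2)

theorem volume_testCap (c : Plane) {r₀ : ℝ} (hr : 0 < r₀) {m : ℕ} (hm : 0 < m) (k : ℕ) (j : ℤ) :
    volume (testCap c r₀ m k j)
      = ENNReal.ofReal (Real.pi * r₀ ^ 2 / 16 / (m * √m)) := by
  have hm' : (0 : ℝ) < m := by exact_mod_cast hm
  rw [testCap, volume_capEllipse _ _ _ (by positivity) (by positivity)]
  congr 1
  have h : √(r₀ * (r₀ / m)) = r₀ / √m := by
    rw [← mul_div_assoc, Real.sqrt_div (by positivity), Real.sqrt_mul_self hr.le]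
  rw [h]
  field_simp
  norm_num

/-- A test set with direction close to `t` lies in the cap of depth `δ = r₀ / m` in direction `t`:
rotating the direction by `1 / (8 m)` moves the coordinate of a point by at most `δ / 2`, and
the half-length `√(r₀ δ) / 2` keeps the ellipse inside the disc. -/
theorem testCap_subset {c : Plane} {r₀ : ℝ} (hr : 0 < r₀) {m k : ℕ} (hk : k < m) {j : ℤ} {t : ℝ}
    (ht : |t - j / (8 * m)| ≤ 1 / (8 * m)) {a : Plane} (ha : a ∈ testCap c r₀ m k j) :
    a ∈ Metric.ball c (2 * r₀ - k * (r₀ / m)) ∧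
      2 * r₀ - k * (r₀ / m) - r₀ / m
        ≤ (a 0 - c 0) * Real.cos t + (a 1 - c 1) * Real.sin t := by
  have hm' : (0 : ℝ) < m := by exact_mod_cast (by omega : 0 < m)
  have hk' : (k : ℝ) + 1 ≤ m := by exact_mod_cast hk
  set τ : ℝ := j / (8 * m)
  set δ := r₀ / m with hδ
  have hδ0 : 0 < δ := by positivity
  have hmδ : m * δ = r₀ := by rw [hδ]; field_simp
  set r := 2 * r₀ - k * δ with hrdef
  have hr1 : r₀ + δ ≤ r := by nlinarith
  have hr2 : r ≤ 2 * r₀ := by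
    have : 0 ≤ k * δ := by positivity
    linarith
  set p := a 0 - c 0
  set q := a 1 - c 1
  set X := p * Real.cos τ + q * Real.sin τ with hX
  set Y := q * Real.cos τ - p * Real.sin τ with hY
  have hXY : p ^ 2 + q ^ 2 = X ^ 2 + Y ^ 2 := by
    rw [hX, hY]
    linear_combination (-p ^ 2 - q ^ 2) * Real.cos_sq_add_sin_sq τ
  have ha' : ((X - (r - 3 * δ / 8)) / (δ / 8)) ^ 2 + (Y / (√(r₀ * δ) / 2)) ^ 2 < 1 := ha
  have h1 : ((X - (r - 3 * δ / 8)) / (δ / 8)) ^ 2 < 1 := by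
    linarith [sq_nonneg (Y / (√(r₀ * δ) / 2))]
  have h2 : (Y / (√(r₀ * δ) / 2)) ^ 2 < 1 := by
    linarith [sq_nonneg ((X - (r - 3 * δ / 8)) / (δ / 8))]
  rw [sq_lt_one_iff_abs_lt_one, abs_div, abs_of_pos (show 0 < δ / 8 by positivity),
    div_lt_one (by positivity), abs_lt] at h1
  rw [div_pow, div_pow, Real.sq_sqrt (by positivity), div_lt_one (by positivity)] at h2
  have hpq : p ^ 2 + q ^ 2 < r ^ 2 := by
    have h3 : X ^ 2 ≤ (r - δ / 4) ^ 2 := pow_le_pow_left₀ (by linarith) (by linarith) 2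
    have h4 : 0 < δ * (r / 2 - δ / 16 - r₀ / 4) := mul_pos hδ0 (by linarith)
    linarith
  have hr0 : 0 < r := by linarith
  refine ⟨?_, ?_⟩
  · rw [Metric.mem_ball, EuclideanSpace.dist_eq, Fin.sum_univ_two, Real.dist_eq, Real.dist_eq,
      sq_abs, sq_abs, Real.sqrt_lt' hr0]
    exact hpq
  · have hp : |p| ≤ 2 * r₀ := (abs_le_of_sq_le_sq (by nlinarith [sq_nonneg q]) hr0.le).trans hr2
    have hq : |q| ≤ 2 * r₀ := (abs_le_of_sq_le_sq (by nlinarith [sq_nonneg p]) hr0.le).trans hr2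
    have hc : |p * (Real.cos t - Real.cos τ)| ≤ 2 * r₀ * (1 / (8 * m)) := by
      rw [abs_mul]
      exact mul_le_mul hp ((Real.abs_cos_sub_cos_le t τ).trans ht) (abs_nonneg _) (by positivity)
    have hs : |q * (Real.sin t - Real.sin τ)| ≤ 2 * r₀ * (1 / (8 * m)) := by
      rw [abs_mul]
      exact mul_le_mul hq ((Real.abs_sin_sub_sin_le t τ).trans ht) (abs_nonneg _) (by positivity)
    have he : 2 * r₀ * (1 / (8 * m)) = δ / 4 := by rw [hδ]; field_simp; norm_num
    rw [he] at hc hs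
    linarith [(abs_le.1 hc).1, (abs_le.1 hs).1]

theorem testCap_subset_ball {c : Plane} {r₀ : ℝ} (hr : 0 < r₀) {m k : ℕ} (hk : k < m) (j : ℤ) :
    testCap c r₀ m k j ⊆ Metric.closedBall c (2 * r₀) := by
  intro a ha
  have h := (testCap_subset hr hk (t := j / (8 * m)) (by rw [sub_self, abs_zero]; positivity)
    ha).1
  refine Metric.ball_subset_closedBall (Metric.ball_subset_ball ?_ h)
  have : 0 ≤ k * (r₀ / m) := by positivity
  linarith

/-- If all test sets contain points of `A`, then at least `m` layers surround the disc of
radius `r₀`. -/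
theorem le_toReal_paretoHeight_of_testCap {φ : Seminorm ℝ Plane} (hφ : ∀ x, φ x = 0 → x = 0)
    (hstrict : StrictConvex ℝ {x : Plane | φ x ≤ 1}) {A : Set Plane} (hA : A.Finite)
    {c : Plane} {r₀ : ℝ} (hr : 0 < r₀) {m : ℕ}
    (h : ∀ k < m, ∀ j ∈ Finset.Icc (-(32 * m : ℤ)) (32 * m), (A ∩ testCap c r₀ m k j).Nonempty)
    {x : Plane} (hx : x ∈ Metric.ball c r₀) :
    (m : ℝ) ≤ (paretoHeight φ A x).toReal := by
  refine le_toReal_paretoHeight hφ hstrict hA fun k hk => ?_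
  have hm' : (0 : ℝ) < m := by exact_mod_cast (by omega : 0 < m)
  refine ball_subset_interior_peel hA (c := c) (R := 2 * r₀) (δ := r₀ / m) (m := m) ?_ k hk
    (Metric.ball_subset_ball ?_ hx)
  · intro k hk t ht
    have hfl := Int.floor_le (t * (8 * m))
    have hfl' := (Int.lt_floor_add_one (t * (8 * m))).le
    have ht' := abs_le.1 ht
    -- `|t| ≤ π ≤ 4`, so that the grid index `⌊8 m t⌋` is between `-32 m` and `32 m`
    have hpi := Real.pi_le_four
    obtain ⟨a, haA, ha⟩ := h k hk ⌊t * (8 * m)⌋ (by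
      rw [Finset.mem_Icc]
      constructor
      · rw [Int.le_floor]
        push_cast
        nlinarith
      · rw [← Int.cast_le (R := ℝ)]
        push_cast
        nlinarith)
    have h1 := testCap_subset hr hk (t := t) (by
      rw [abs_of_nonneg]
      · rw [sub_le_iff_le_add, ← add_div, le_div_iff₀ (by positivity)]
        linarith
      · rw [sub_nonneg, div_le_iff₀ (by positivity)]
        exact hfl) ha
    exact ⟨a, ⟨haA, h1.1⟩, h1.2⟩
  · have hk' : (k : ℝ) + 1 ≤ m := by exact_mod_cast hk
    have hmδ : m * (r₀ / m) = r₀ := by field_simp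
    have : 0 < r₀ / m := by positivity
    nlinarith

/-! ### Poisson points in the test sets -/

theorem IsPoissonProcess.measure_inter_eq_empty_le {Ω : Type*} [MeasurableSpace Ω]
    {P : Measure Ω} {μ : Measure Plane} {X : Ω → Set Plane} (hX : IsPoissonProcess P μ X)
    {B : Set Plane} (hB : MeasurableSet B) (hBtop : μ B ≠ ∞) {b : ℝ}
    (hb : ENNReal.ofReal b ≤ μ B) :
    P {ω | X ω ∩ B = ∅} ≤ ENNReal.ofReal (Real.exp (-b)) := by
  have h1 : {ω | X ω ∩ B = ∅} = (fun ω => (X ω ∩ B).encard) ⁻¹' {0} := by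
    ext ω
    simp
  have h2 : (fun k : ℕ => (k : ℕ∞)) ⁻¹' {0} = {0} := by
    ext k
    simp
  rw [h1, ← Measure.map_apply (hX.measurable_count B hB) (measurableSet_singleton _),
    hX.law_count B hB hBtop, Measure.map_apply (by fun_prop) (measurableSet_singleton _), h2,
    poissonMeasure_singleton]
  refine ENNReal.ofReal_le_ofReal ?_
  simp only [pow_zero, mul_one, Nat.factorial_zero, Nat.cast_one, div_one]
  refine Real.exp_le_exp.2 (neg_le_neg ?_)
  rw [ENNReal.coe_toNNReal_eq_toReal]
  exact (ENNReal.ofReal_le_iff_le_toReal hBtop).1 hb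

theorem IsPoissonProcess.ae_finite {Ω : Type*} [MeasurableSpace Ω]
    {P : Measure Ω} {μ : Measure Plane} [IsFiniteMeasure μ] {X : Ω → Set Plane}
    (hX : IsPoissonProcess P μ X) : ∀ᵐ ω ∂P, (X ω).Finite := by
  have h1 : {ω | ¬ (X ω).Finite} = (fun ω => (X ω ∩ univ).encard) ⁻¹' {⊤} := by
    ext ω
    rw [mem_preimage, mem_singleton_iff, inter_univ, encard_eq_top_iff]
    rfl
  have h2 : (fun k : ℕ => (k : ℕ∞)) ⁻¹' {⊤} = ∅ := by
    ext k
    simp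
  rw [ae_iff, h1,
    ← Measure.map_apply (hX.measurable_count _ MeasurableSet.univ) (measurableSet_singleton _),
    hX.law_count _ MeasurableSet.univ (measure_ne_top _ _),
    Measure.map_apply (by fun_prop) (measurableSet_singleton _), h2, measure_empty]

theorem isFiniteMeasure_intensityMeasure {U : Set Plane} (hU : IsOpen U)
    (hUb : Bornology.IsBounded U) {g : Plane → ℝ} {C : ℝ} (hg : ∀ x ∈ U, g x ≤ C) :
    IsFiniteMeasure (intensityMeasure U g) := by
  refine ⟨?_⟩
  rw [intensityMeasure, withDensity_apply _ MeasurableSet.univ, Measure.restrict_univ]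
  refine (setLIntegral_mono' (g := fun _ => ENNReal.ofReal C) hU.measurableSet
    fun x hx => ENNReal.ofReal_le_ofReal (hg x hx)).trans_lt ?_
  rw [setLIntegral_const]
  exact ENNReal.mul_lt_top ENNReal.ofReal_lt_top hUb.measure_lt_top

theorem le_intensityMeasure {U B : Set Plane} (hB : MeasurableSet B) (hBU : B ⊆ U)
    {g : Plane → ℝ} {κ : ℝ} (hg : ∀ x ∈ B, κ ≤ g x) :
    ENNReal.ofReal κ * volume B ≤ intensityMeasure U g B := by
  rw [intensityMeasure, withDensity_apply _ hB, Measure.restrict_restrict hB,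
    inter_eq_left.2 hBU, ← setLIntegral_const]
  exact setLIntegral_mono' hB fun x hx => ENNReal.ofReal_le_ofReal (hg x hx)

/-- The number of test sets times the probability that one is empty, in terms of `m`. The power
`m ^ (-4)` corresponds to `n ^ (-2)`, which is summable; it comes from the term of order `12` of
the exponential series. -/
theorem sq_mul_exp_neg_le {L m : ℝ} (hL : 0 < L) (hm : 0 < m) :
    m ^ 2 * Real.exp (-(L * √m)) ≤ (Nat.factorial 12 : ℝ) / L ^ 12 / m ^ 4 := by
  have h := Real.pow_div_factorial_le_exp (x := L * √m) (by positivity) 12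
  have h1 : (L * √m) ^ 12 = L ^ 12 * m ^ 6 := by
    rw [mul_pow, show √m ^ 12 = (√m ^ 2) ^ 6 by ring, Real.sq_sqrt hm.le]
  have hfac : (0 : ℝ) < Nat.factorial 12 := by positivity
  rw [h1] at h
  rw [Real.exp_neg, ← div_eq_mul_inv, div_le_iff₀ (Real.exp_pos _)]
  calc m ^ 2 = (Nat.factorial 12 : ℝ) / L ^ 12 / m ^ 4
        * (L ^ 12 * m ^ 6 / (Nat.factorial 12 : ℝ)) := by field_simp
    _ ≤ _ := by gcongr

/-- Almost surely, for all large `n` every one of the test sets with `m = ⌈M √n⌉` contains a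
point of the process. A test set has area `∼ m ^ (-3 / 2)`, hence is empty with probability at
most `exp (-L √m)`, while there are only `O (m ^ 2)` of them. -/
theorem ae_eventually_testCap_nonempty {U : Set Plane} (hU : IsOpen U)
    (hUb : Bornology.IsBounded U) {f : Plane → ℝ} {C : ℝ} (hC : ∀ x ∈ U, f x ≤ C)
    {Ω : Type*} [MeasurableSpace Ω] {P : Measure Ω} {X : ℕ → Ω → Set Plane}
    (hX : ∀ n : ℕ, 1 ≤ n → IsPoissonProcess P (intensityMeasure U fun x => (n : ℝ) * f x) (X n))
    {c : Plane} {r₀ κ : ℝ} (hr : 0 < r₀) (hκ : 0 < κ) (hcU : Metric.closedBall c (2 * r₀) ⊆ U)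
    (hf : ∀ x ∈ Metric.closedBall c (2 * r₀), κ ≤ f x) {M : ℕ} (hM : 1 ≤ M) :
    ∀ᵐ ω ∂P, ∀ᶠ n : ℕ in atTop, ∀ k < ⌈M * √(n : ℝ)⌉₊,
      ∀ j ∈ Finset.Icc (-(32 * ⌈M * √(n : ℝ)⌉₊ : ℤ)) (32 * ⌈M * √(n : ℝ)⌉₊),
        (X n ω ∩ testCap c r₀ ⌈M * √(n : ℝ)⌉₊ k j).Nonempty := by
  set m : ℕ → ℕ := fun n => ⌈M * √(n : ℝ)⌉₊ with hmdef
  let I : ℕ → Finset (ℕ × ℤ) := fun n =>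
    Finset.range (m n) ×ˢ Finset.Icc (-(32 * m n : ℤ)) (32 * m n)
  set s : ℕ → Set Ω := fun n => ⋃ i ∈ I n, {ω | X n ω ∩ testCap c r₀ (m n) i.1 i.2 = ∅} with hs
  set L : ℝ := κ * (Real.pi * r₀ ^ 2 / 16) / ((M : ℝ) + 1) ^ 2 with hL
  have hLpos : 0 < L := by positivity
  set D : ℝ := 65 * ((Nat.factorial 12 : ℝ) / L ^ 12) with hD
  have hDpos : 0 < D := by positivity
  have hbound : ∀ n, P (s n) ≤ ENNReal.ofReal (D * (1 / (n : ℝ) ^ 2)) := by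
    intro n
    rcases Nat.eq_zero_or_pos n with rfl | hn
    · simp [hs, I, hmdef]
    have hn1 : (1 : ℝ) ≤ n := by exact_mod_cast hn
    have hM1 : (1 : ℝ) ≤ M := by exact_mod_cast hM
    have hsn : 1 ≤ √(n : ℝ) := Real.one_le_sqrt.2 hn1
    have hsq : √(n : ℝ) ^ 2 = n := Real.sq_sqrt (by positivity)
    have hm_lower : √(n : ℝ) ≤ m n := by
      refine le_trans ?_ (Nat.le_ceil (M * √(n : ℝ)))
      nlinarith
    have hm_upper : (m n : ℝ) ≤ (M + 1) * √(n : ℝ) := by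
      have := (Nat.ceil_lt_add_one (a := M * √(n : ℝ)) (by positivity)).le
      simp only [hmdef]
      linarith
    have hm1 : (1 : ℝ) ≤ m n := hsn.trans hm_lower
    have hmpos : 0 < m n := by exact_mod_cast (zero_lt_one.trans_le hm1)
    have hmpos' : (0 : ℝ) < m n := by exact_mod_cast hmpos
    have hfin := isFiniteMeasure_intensityMeasure hU hUb (g := fun x => (n : ℝ) * f x)
      (C := n * C) fun x hx => mul_le_mul_of_nonneg_left (hC x hx) (by positivity)
    have hone : ∀ i ∈ I n, P {ω | X n ω ∩ testCap c r₀ (m n) i.1 i.2 = ∅}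
        ≤ ENNReal.ofReal (Real.exp (-(L * √(m n : ℝ)))) := by
      intro i hi
      have hi1 : i.1 < m n := Finset.mem_range.1 (Finset.mem_product.1 hi).1
      have hmeas : MeasurableSet (testCap c r₀ (m n) i.1 i.2) := measurableSet_capEllipse ..
      have hsub := testCap_subset_ball (c := c) hr hi1 i.2
      refine (hX n hn).measure_inter_eq_empty_le hmeas (measure_ne_top _ _) ?_
      refine le_trans ?_ (le_intensityMeasure hmeas (hsub.trans hcU) (κ := n * κ)
        fun x hx => mul_le_mul_of_nonneg_left (hf x (hsub hx)) (by positivity))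
      rw [volume_testCap c hr hmpos, ← ENNReal.ofReal_mul (by positivity)]
      refine ENNReal.ofReal_le_ofReal ?_
      have hmn : (m n : ℝ) ^ 2 ≤ (M + 1) ^ 2 * n := by
        rw [← hsq, ← mul_pow]
        gcongr
      have e1 : L * √(m n : ℝ) = κ * (Real.pi * r₀ ^ 2 / 16) / (m n * √(m n : ℝ))
          * (m n ^ 2 / (M + 1) ^ 2) := by
        have : √(m n : ℝ) ^ 2 = m n := Real.sq_sqrt hmpos'.le
        have h0 : 0 < √(m n : ℝ) := Real.sqrt_pos.2 hmpos'
        rw [hL]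
        field_simp
        linear_combination this
      have e2 : n * κ * (Real.pi * r₀ ^ 2 / 16 / (m n * √(m n : ℝ)))
          = κ * (Real.pi * r₀ ^ 2 / 16) / (m n * √(m n : ℝ)) * n := by ring
      rw [e1, e2]
      refine mul_le_mul_of_nonneg_left ?_ (by positivity)
      rw [div_le_iff₀ (by positivity)]
      linarith
    have hcard : ((I n).card : ℝ) ≤ 65 * (m n : ℝ) ^ 2 := by
      have : (I n).card = m n * (64 * m n + 1) := by
        simp only [I, Finset.card_product, Finset.card_range, Int.card_Icc]
        congr 1
        omega
      rw [this]
      push_cast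
      nlinarith
    calc P (s n) ≤ ∑ i ∈ I n, P {ω | X n ω ∩ testCap c r₀ (m n) i.1 i.2 = ∅} :=
          measure_biUnion_finset_le _ _
      _ ≤ ∑ i ∈ I n, ENNReal.ofReal (Real.exp (-(L * √(m n : ℝ)))) := Finset.sum_le_sum hone
      _ = ENNReal.ofReal ((I n).card * Real.exp (-(L * √(m n : ℝ)))) := by
          rw [Finset.sum_const, nsmul_eq_mul, ENNReal.ofReal_mul (by positivity),
            ENNReal.ofReal_natCast]
      _ ≤ ENNReal.ofReal (D * (1 / (n : ℝ) ^ 2)) := by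
          refine ENNReal.ofReal_le_ofReal ?_
          calc ((I n).card : ℝ) * Real.exp (-(L * √(m n : ℝ)))
              ≤ 65 * (m n : ℝ) ^ 2 * Real.exp (-(L * √(m n : ℝ))) := by gcongr
            _ = 65 * ((m n : ℝ) ^ 2 * Real.exp (-(L * √(m n : ℝ)))) := by ring
            _ ≤ 65 * ((Nat.factorial 12 : ℝ) / L ^ 12 / (m n : ℝ) ^ 4) := by
                gcongr
                exact sq_mul_exp_neg_le hLpos hmpos'
            _ = D * (1 / (m n : ℝ) ^ 4) := by rw [hD]; ring
            _ ≤ D * (1 / (n : ℝ) ^ 2) := by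
                have : (n : ℝ) ^ 2 ≤ (m n : ℝ) ^ 4 := by
                  calc (n : ℝ) ^ 2 = √(n : ℝ) ^ 4 := by
                        rw [show √(n : ℝ) ^ 4 = (√(n : ℝ) ^ 2) ^ 2 by ring, hsq]
                    _ ≤ (m n : ℝ) ^ 4 := by gcongr
                gcongr
  have hsum : ∑' n, P (s n) ≠ ∞ := by
    refine ne_top_of_le_ne_top ?_ (ENNReal.tsum_le_tsum hbound)
    exact ((Real.summable_one_div_nat_pow.2 one_lt_two).mul_left D).tsum_ofReal_ne_top
  filter_upwards [ae_eventually_notMem hsum] with ω hω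
  filter_upwards [hω] with n hn k hk j hj
  rw [nonempty_iff_ne_empty]
  intro hempty
  refine hn (mem_iUnion₂.2 ⟨(k, j), Finset.mem_product.2 ⟨Finset.mem_range.2 hk, hj⟩, hempty⟩)

/-! ### Growth of the height function -/

theorem corollary1p2
    (φ : Seminorm ℝ Plane) (hφ : ∀ x, φ x = 0 → x = 0)
    (hstrict : StrictConvex ℝ {x : Plane | φ x ≤ 1}) :
    (∀ A : Set Plane, A.Finite → ∀ k : ℕ,
      peel (paretoHull φ) A k = peel (fun S => convexHull ℝ S) A k) ∧
    ∀ (U : Set Plane), IsOpen U → Bornology.IsBounded U → IsParetoEfficient φ U →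
    ∀ (f : Plane → ℝ), ContinuousOn f U → (∀ x ∈ U, 0 < f x) → (∃ C : ℝ, ∀ x ∈ U, f x ≤ C) →
    ∀ {Ω : Type*} [MeasurableSpace Ω] (P : Measure Ω) [IsProbabilityMeasure P]
      (X : ℕ → Ω → Set Plane),
      (∀ n : ℕ, 1 ≤ n → IsPoissonProcess P (intensityMeasure U fun x => (n : ℝ) * f x) (X n)) →
      ∀ᵐ ω ∂P, TendstoInftyLocallyUniformlyOn
        (fun n x => (n : ℝ) ^ (-(1 / 2) : ℝ) * (paretoHeight φ (X n ω) x).toReal) U := by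
  refine ⟨fun A hA k => peel_paretoHull_eq hφ hstrict hA k, ?_⟩
  intro U hU hUb _ f hfc hfpos ⟨C, hC⟩ Ω _ P _ X hX
  -- doubled discs contained in `U`, countably many of which cover `U`
  have hball : ∀ x ∈ U, ∃ r : ℝ, 0 < r ∧ Metric.closedBall x (2 * r) ⊆ U := by
    intro x hx
    obtain ⟨ε, hε, hsub⟩ := Metric.nhds_basis_closedBall.mem_iff.1 (hU.mem_nhds hx)
    exact ⟨ε / 2, by positivity, by rwa [mul_div_cancel₀ _ (two_ne_zero' ℝ)]⟩
  choose! r hr hrU using hball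
  obtain ⟨t, htU, htc, hcover⟩ := TopologicalSpace.countable_cover_nhdsWithin
    (f := fun x => Metric.ball x (r x)) (s := U)
    fun x hx => mem_nhdsWithin_of_mem_nhds (Metric.ball_mem_nhds x (hr x hx))
  have hfin : ∀ᵐ ω ∂P, ∀ n : ℕ, 1 ≤ n → (X n ω).Finite := by
    rw [ae_all_iff]
    intro n
    by_cases hn : 1 ≤ n
    · have := isFiniteMeasure_intensityMeasure hU hUb (g := fun x => (n : ℝ) * f x)
        (C := n * C) fun x hx => mul_le_mul_of_nonneg_left (hC x hx) (by positivity)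
      filter_upwards [(hX n hn).ae_finite] with ω hω _ using hω
    · exact Eventually.of_forall fun ω h => absurd h hn
  have htest : ∀ᵐ ω ∂P, ∀ x ∈ t, ∀ M : ℕ, 1 ≤ M → ∀ᶠ n : ℕ in atTop,
      ∀ k < ⌈M * √(n : ℝ)⌉₊,
      ∀ j ∈ Finset.Icc (-(32 * ⌈M * √(n : ℝ)⌉₊ : ℤ)) (32 * ⌈M * √(n : ℝ)⌉₊),
        (X n ω ∩ testCap x (r x) ⌈M * √(n : ℝ)⌉₊ k j).Nonempty := by
    rw [ae_ball_iff htc]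
    intro x hx
    rw [ae_all_iff]
    intro M
    by_cases hM : 1 ≤ M
    · obtain ⟨y, hy, hmin⟩ := (isCompact_closedBall x (2 * r x)).exists_isMinOn
        ⟨x, Metric.mem_closedBall_self (by linarith [hr x (htU hx)])⟩
        (hfc.mono (hrU x (htU hx)))
      filter_upwards [ae_eventually_testCap_nonempty hU hUb hC hX (hr x (htU hx))
        (hfpos y (hrU x (htU hx) hy)) (hrU x (htU hx)) (fun z hz => hmin hz) hM] with ω hω _
        using hω
    · exact Eventually.of_forall fun ω h => absurd h hM
  filter_upwards [hfin, htest] with ω hωfin hωtest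
  intro K hKU hK M
  obtain ⟨t', ht't, ht'fin, hKt'⟩ := hK.elim_finite_subcover_image (b := t)
    (c := fun x => Metric.ball x (r x)) (fun _ _ => Metric.isOpen_ball) (hKU.trans hcover)
  -- an integer multiple of `√n` that is at least `M √n`, with a positive factor
  have hev := (ht'fin.eventually_all (l := atTop)).2 fun x hx =>
    hωtest x (ht't hx) (⌈M⌉₊ + 1) (by omega)
  filter_upwards [hev, eventually_ge_atTop 1] with n hn hn1 z hz
  obtain ⟨x, hx, hzx⟩ := mem_iUnion₂.1 (hKt' hz)
  have h1 := le_toReal_paretoHeight_of_testCap hφ hstrict (hωfin n hn1)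
    (hr x (htU (ht't hx))) (hn x hx) hzx
  have hn1' : (1 : ℝ) ≤ n := by exact_mod_cast hn1
  have hsn : 0 < √(n : ℝ) := Real.sqrt_pos.2 (by linarith)
  have h2 := (Nat.le_ceil (((⌈M⌉₊ + 1 : ℕ) : ℝ) * √(n : ℝ))).trans h1
  have h3 : M ≤ ((⌈M⌉₊ + 1 : ℕ) : ℝ) := by
    push_cast
    linarith [Nat.le_ceil M]
  rw [Real.rpow_neg (by positivity), ← Real.sqrt_eq_rpow, ← div_eq_inv_mul, le_div_iff₀ hsn]
  exact (mul_le_mul_of_nonneg_right h3 hsn.le).trans h2
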